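/- Throughout, $W$ is a binary erasure channel with erasure probability $z=Z(W)$ and capacity $I(W)=1-z$. Start from $2^n$ independent copies of $W$ and put $W_1^{(1)}=W$. For $1\le j\le N=2^m$, let $W_{2N}^{(2j-1)}$ and $W_{2N}^{(2j)}$ be the synthetic channels made from two independent copies of $W_N^{(j)}$ (living on disjoint blocks of $N$ copies of $W$), where $W_{2N}^{(2j-1)}$ erases iff at least one of the two copies erases, and $W_{2N}^{(2j)}$ erases iff both do. A polar code of block length $N_n=2^n$ is a subset $\mathcal A_n$ of the $2^n$ synthetic channels of depth $n$; its rate is $R_n=|\mathcal A_n|/2^n$, and its block error probability $P_n$ is the probability that at least one channel in $\mathcal A_n$ erases. A pair $(\beta',\mu')$ is achievable over $W$ if there are polar codes $\mathcal A_n$ with $$P_n\le 2^n\cdot 2^{-2^{\beta' n}}\ \text{ for all large } n,\qquad I(W)-R_n=O\bigl(2^{-n/\mu'}\bigr).$$ Let $H_2$ be the binary entropy function (in bits) and $H_2^{-1}:[0,1]\to[0,1/2]$ the inverse of its restriction to $[0,1/2]$. (1) Let $\mu^*>2$ and let $h:[0,1]\to[0,1]$ satisfy $h(0)=h(1)=0$,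 $h(\xi)>0$ for $0<\xi<1$, and $\inf_K h>0$ for every compact $K\subset(0,1)$ (for instance, $h$ continuous), and $$\sup_{0<\xi<1}\frac{h(\xi^2)+h(2\xi-\xi^2)}{2h(\xi)}<2^{-1/\mu^*}.$$ For $\frac1{1+\mu^*}<\gamma<1$ put $$\beta'=\gamma H_2^{-1}\Bigl(\frac{\gamma(\mu^*+1)-1}{\gamma\mu^*}\Bigr),\qquad \mu'=\frac{\mu^*}{1-\gamma}.$$ Then $(\beta',\mu')$ satisfies, for all $\pi\in[0,1]$, $$\frac{1-\pi}{\mu'-\mu^*\pi}+H_2\Bigl(\frac{\beta'\mu'}{\mu'-\mu^*\pi}\Bigr)<1,$$ and $(\beta',\mu')$ is achievable over every binary erasure channel ($0\le z\le 1$). Moreover $\beta'\to\frac12$ as $\gamma\to1^-$. (2) The limiting value is the error exponent of polar coding: for every $0<z<1$ and every $0<R<I(W)$, $$\beta:=\sup\ \liminf_{n\to\infty}\frac{\log(-\log P_n)}{\log N_n}=\frac12,$$ the supremum being over all sequences of polar codes $(\mathcal A_n)$ with $R_n\ge R$ for all $n$. -/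

import Mathlib

open Filter Topology Asymptotics

namespace PolarCode

/-! ### Binary entropy -/

/-- The binary entropy function in bits. -/
noncomputable def H₂ (p : ℝ) : ℝ := Real.binEntropy p / Real.log 2

/-- The inverse of `H₂` on the branch `[0, 1/2]`, a function from `[0, 1]` to `[0, 1/2]`. -/
noncomputable def H₂inv (y : ℝ) : ℝ := Function.invFunOn H₂ (Set.Icc 0 (1 / 2)) y

/-! ### Polar codes on the binary erasure channel -/

/-- `synthErased n i e` says that the synthetic channel with number `i + 1` among the `2 ^ n`
synthetic channels of depth `n` erases its input, where `e k` says that the `k`-th of the `2 ^ n`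
independent copies of the root channel erases its input (`0 ≤ i, k < 2 ^ n`).
The channels numbered `2 * j - 1` and `2 * j` of depth `n + 1` are made of two independent copies
of the channel numbered `j` of depth `n`: the first of them erases if at least one of the copies
does, and the second erases if both copies do. -/
def synthErased : ℕ → ℕ → (ℕ → Prop) → Prop
  | 0, _, e => e 0
  | n + 1, i, e =>
    if i % 2 = 0 then
      synthErased n (i / 2) e ∨ synthErased n (i / 2) (fun k => e (2 ^ n + k))
    else
      synthErased n (i / 2) e ∧ synthErased n (i / 2) (fun k => e (2 ^ n + k))

/-- A polar code of block length `2 ^ n`: the set of the synthetic channels that carry messages. -/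
abbrev Code (n : ℕ) : Type := Finset (Fin (2 ^ n))

/-- The code rate. -/
noncomputable def rate {n : ℕ} (A : Code n) : ℝ := (A.card : ℝ) / 2 ^ n

/-- The capacity of the binary erasure channel with erasure probability `z`. -/
def capacity (z : ℝ) : ℝ := 1 - z

open Classical in
/-- The block error probability of the polar code `A` over the binary erasure channel with erasure
probability `z`: the probability that at least one of the synthetic channels in `A` erases its
message. The sum runs over the set `S` of the copies of the root channel that erase. -/
noncomputable def blockError (z : ℝ) {n : ℕ} (A : Code n) : ℝ :=
  ∑ S ∈ (Finset.range (2 ^ n)).powerset,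
    if ∃ i ∈ A, synthErased n i (fun k => k ∈ S) then
      z ^ S.card * (1 - z) ^ (2 ^ n - S.card)
    else 0

/-- The pair `(β, μ)` is achievable by polar codes over the binary erasure channel with erasure
probability `z`. -/
def Achievable (z β μ : ℝ) : Prop :=
  ∃ A : (n : ℕ) → Code n,
    (∀ᶠ n : ℕ in atTop,
      blockError z (A n) ≤ (2 : ℝ) ^ n * (2 : ℝ) ^ (-((2 : ℝ) ^ (β * (n : ℝ))))) ∧
    (fun n : ℕ => capacity z - rate (A n)) =O[atTop] (fun n : ℕ => (2 : ℝ) ^ (-(n : ℝ) / μ))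

/-- The error exponent `liminf log (- log Pₙ) / log Nₙ` of a sequence of polar codes. -/
noncomputable def seqErrorExponent (z : ℝ) (A : (n : ℕ) → Code n) : EReal :=
  liminf (fun n : ℕ =>
    ((Real.log (-Real.log (blockError z (A n))) / Real.log ((2 : ℝ) ^ n) : ℝ) : EReal)) atTop

/-- The error exponent of polar coding at rates bounded from below by `R`. -/
noncomputable def errorExponent (z R : ℝ) : EReal :=
  sSup {b : EReal | ∃ A : (n : ℕ) → Code n, (∀ n, R ≤ rate (A n)) ∧ b = seqErrorExponent z A}

/-! ### The two conditions and the parametrized pair -/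

/-- The hypothesis on `h` and `μs` (written `μ*`). The supremum over `0 < ξ < 1` of the ratio is
less than `2 ^ (-1 / μ*)` exactly when some `c < 2 ^ (-1 / μ*)` bounds the ratio. -/
structure EigenCondition (h : ℝ → ℝ) (μs : ℝ) : Prop where
  mapsTo : Set.MapsTo h (Set.Icc 0 1) (Set.Icc 0 1)
  zero : h 0 = 0
  one : h 1 = 0
  pos : ∀ ξ ∈ Set.Ioo (0 : ℝ) 1, 0 < h ξ
  /-- `h` is bounded away from zero on compact subsets of `(0, 1)`; automatic for continuous `h`. -/
  locally_pos : ∀ a ∈ Set.Ioo (0 : ℝ) (1 / 2), ∃ c > 0, ∀ ξ ∈ Set.Icc a (1 - a), c ≤ h ξ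
  two_lt : 2 < μs
  sup_lt : ∃ c < (2 : ℝ) ^ (-1 / μs), ∀ ξ ∈ Set.Ioo (0 : ℝ) 1,
    (h (ξ ^ 2) + h (2 * ξ - ξ ^ 2)) / (2 * h ξ) ≤ c

/-- The main condition on `(β, μ)` relative to `μs` (written `μ*`). -/
def MainCondition (μs β μ : ℝ) : Prop :=
  ∀ π ∈ Set.Icc (0 : ℝ) 1, (1 - π) / (μ - μs * π) + H₂ (β * μ / (μ - μs * π)) < 1

/-- `β' = γ H₂⁻¹ ((γ (μ* + 1) - 1) / (γ μ*))`. -/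
noncomputable def betaOf (μs γ : ℝ) : ℝ := γ * H₂inv ((γ * (μs + 1) - 1) / (γ * μs))

/-- `μ' = μ* / (1 - γ)`. -/
noncomputable def muOf (μs γ : ℝ) : ℝ := μs / (1 - γ)

end PolarCode

/-! One polarization step over the erasure channel replaces an erasure probability `x` by `x ^ 2` (a
good step) or by `2 * x - x ^ 2`. Since the copies are independent, these probabilities are exact.
The block error lies between the largest erasure probability in the code and their sum, so both
parts of the theorem reduce to counting the indices `i` by the size of `erasureProb z n i`.

Achievability: split `n = m + t` with `t` about `γ * n`. During the first `m` steps the average of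
`h`, slightly perturbed, decays like `2 ^ (-m / μs)`, while the average of `x` stays equal to `z`.
Hence all but a fraction `z + O(2 ^ (-m / μs))` of the channels have erasure probability at most `2
^ (-(n + 1))` (`EigenCondition.card_not_reliable_le`). During the last `t` steps a bad step at most
doubles `x`, which the small starting value can afford, and a good step squares it
(`erasureProb_add_le`). By a Chernoff bound (`card_goodSteps_le`) all but a fraction `2 ^ (-t * (1 -
H₂ p))` of the indices have more than `p * t` good steps. The definition of `betaOf` chooses `p` so
that the two losses in rate have the same order.

Error exponent: achievability with `γ → 1` gives every exponent below `1 / 2`, once some `h` is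
known to satisfy the hypothesis; `√(x * (1 - x))` does. Conversely, by Chebyshev almost all indices
have about `n / 2` good steps, so a code of rate at least `R > 0` contains one with at most `b * n`,
for any `b > 1 / 2`; its erasure probability is at least `z ^ 2 ^ (b * n)`. -/

namespace PolarCode

/-! ### Erasure probabilities of the synthetic channels -/

/-- The erasure probability of the synthetic channel `i + 1` of depth `n`. -/
noncomputable def erasureProb (z : ℝ) : ℕ → ℕ → ℝ
  | 0, _ => z
  | n + 1, i =>
    if i % 2 = 0 then 2 * erasureProb z n (i / 2) - erasureProb z n (i / 2) ^ 2
    else erasureProb z n (i / 2) ^ 2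

/-- The number of squaring steps among the last `t` steps that lead to the channel `i + 1`. -/
def goodSteps : ℕ → ℕ → ℕ
  | 0, _ => 0
  | t + 1, i => goodSteps t (i / 2) + i % 2

theorem erasureProb_bit0 (z : ℝ) (n j : ℕ) :
    erasureProb z (n + 1) (2 * j) = 2 * erasureProb z n j - erasureProb z n j ^ 2 := by
  simp [erasureProb]

theorem erasureProb_bit1 (z : ℝ) (n j : ℕ) :
    erasureProb z (n + 1) (2 * j + 1) = erasureProb z n j ^ 2 := by
  have h : (2 * j + 1) / 2 = j := by omega
  simp [erasureProb, h, Nat.add_mod]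

theorem goodSteps_bit0 (t j : ℕ) : goodSteps (t + 1) (2 * j) = goodSteps t j := by
  simp [goodSteps]

theorem goodSteps_bit1 (t j : ℕ) : goodSteps (t + 1) (2 * j + 1) = goodSteps t j + 1 := by
  have h : (2 * j + 1) / 2 = j := by omega
  simp [goodSteps, h, Nat.add_mod]

theorem sum_range_two_mul (f : ℕ → ℝ) (m : ℕ) :
    ∑ i ∈ Finset.range (2 * m), f i = ∑ j ∈ Finset.range m, (f (2 * j) + f (2 * j + 1)) := by
  induction m with
  | zero => simp
  | succ m ih =>
    rw [Finset.sum_range_succ _ m, ← ih, show 2 * (m + 1) = 2 * m + 1 + 1 by ring,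
      Finset.sum_range_succ, Finset.sum_range_succ, add_assoc]

theorem sum_range_two_pow_succ (f : ℕ → ℝ) (n : ℕ) :
    ∑ i ∈ Finset.range (2 ^ (n + 1)), f i =
      ∑ j ∈ Finset.range (2 ^ n), (f (2 * j) + f (2 * j + 1)) := by
  rw [pow_succ', sum_range_two_mul]

/-- Every channel of depth `n` has `2 ^ t` descendants of depth `n + t`. -/
theorem sum_range_two_pow_add_div (f : ℕ → ℝ) (n t : ℕ) :
    ∑ i ∈ Finset.range (2 ^ (n + t)), f (i / 2 ^ t) =
      2 ^ t * ∑ j ∈ Finset.range (2 ^ n), f j := by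
  induction t with
  | zero => simp
  | succ t ih =>
    rw [← add_assoc, sum_range_two_pow_succ, pow_succ (2 : ℝ), mul_right_comm, ← ih,
      Finset.sum_mul]
    refine Finset.sum_congr rfl fun j _ => ?_
    have h0 : 2 * j / 2 ^ (t + 1) = j / 2 ^ t := by
      rw [pow_succ', ← Nat.div_div_eq_div_mul]; congr 1; omega
    have h1 : (2 * j + 1) / 2 ^ (t + 1) = j / 2 ^ t := by
      rw [pow_succ', ← Nat.div_div_eq_div_mul]; congr 1; omega
    rw [h0, h1]; ring

/-- The binomial generating function: each of the last `t` steps contributes a factor `1 + lam`,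
each earlier one a factor 2. -/
theorem sum_pow_goodSteps (lam : ℝ) (n t : ℕ) :
    ∑ i ∈ Finset.range (2 ^ (n + t)), lam ^ goodSteps t i = 2 ^ n * (1 + lam) ^ t := by
  induction t with
  | zero => simp [goodSteps]
  | succ t ih =>
    rw [← add_assoc, sum_range_two_pow_succ, pow_succ (1 + lam), ← mul_assoc, ← ih,
      Finset.sum_mul]
    refine Finset.sum_congr rfl fun j _ => ?_
    rw [goodSteps_bit0, goodSteps_bit1]; ring

/-- The variance of a symmetric walk with steps `±1`: the cross terms of the two children cancel. -/
theorem sum_sq_goodSteps (n : ℕ) :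
    ∑ i ∈ Finset.range (2 ^ n), (2 * (goodSteps n i : ℝ) - (n : ℝ)) ^ 2 = (2 : ℝ) ^ n * n := by
  induction n with
  | zero => simp [goodSteps]
  | succ n ih =>
    have : ∀ j : ℕ, (2 * (goodSteps (n + 1) (2 * j) : ℝ) - (n + 1 : ℕ)) ^ 2 +
        (2 * (goodSteps (n + 1) (2 * j + 1) : ℝ) - (n + 1 : ℕ)) ^ 2 =
        2 * (2 * (goodSteps n j : ℝ) - n) ^ 2 + 2 := fun j => by
      rw [goodSteps_bit0, goodSteps_bit1]; push_cast; ring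
    rw [sum_range_two_pow_succ, Finset.sum_congr rfl fun j _ => this j, Finset.sum_add_distrib,
      ← Finset.mul_sum, ih]
    simp; ring

theorem erasureProb_mem_Icc {z : ℝ} (hz : z ∈ Set.Icc (0 : ℝ) 1) (n i : ℕ) :
    erasureProb z n i ∈ Set.Icc (0 : ℝ) 1 := by
  induction n generalizing i with
  | zero => exact hz
  | succ n ih =>
    obtain ⟨h0, h1⟩ := ih (i / 2)
    rw [erasureProb]
    split_ifs
    · constructor <;> nlinarith
    · constructor <;> nlinarith

/-- The martingale property: the two children of `x` sum to `2 * x`. -/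
theorem sum_erasureProb (z : ℝ) (n : ℕ) :
    ∑ i ∈ Finset.range (2 ^ n), erasureProb z n i = 2 ^ n * z := by
  induction n with
  | zero => simp [erasureProb]
  | succ n ih =>
    rw [sum_range_two_pow_succ, pow_succ (2 : ℝ), mul_right_comm, ← ih, Finset.sum_mul]
    refine Finset.sum_congr rfl fun j _ => ?_
    rw [erasureProb_bit0, erasureProb_bit1]; ring

/-- Bad steps never decrease the erasure probability, so only the squarings matter. -/
theorem pow_two_pow_goodSteps_le {z : ℝ} (hz : z ∈ Set.Icc (0 : ℝ) 1) (n i : ℕ) :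
    z ^ 2 ^ goodSteps n i ≤ erasureProb z n i := by
  induction n generalizing i with
  | zero => simp [goodSteps, erasureProb]
  | succ n ih =>
    obtain ⟨h0, h1⟩ := erasureProb_mem_Icc hz n (i / 2)
    have h := ih (i / 2)
    rw [goodSteps, erasureProb]
    split_ifs with hi
    · rw [hi, add_zero]; nlinarith
    · rw [Nat.mod_two_ne_zero.1 hi, pow_succ 2, pow_mul]
      exact pow_le_pow_left₀ (pow_nonneg hz.1 _) h 2

/-- All doublings are paid for in advance, inside the base: `2 * y ^ k ≤ (2 * y) ^ k` for `k ≥ 1`.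
-/
theorem erasureProb_add_le {z : ℝ} (hz : z ∈ Set.Icc (0 : ℝ) 1) (n t i : ℕ) :
    erasureProb z (n + t) i ≤ (2 ^ t * erasureProb z n (i / 2 ^ t)) ^ 2 ^ goodSteps t i := by
  induction t generalizing i with
  | zero => simp [goodSteps]
  | succ t ih =>
    obtain ⟨h0, -⟩ := erasureProb_mem_Icc hz (n + t) (i / 2)
    obtain ⟨hx, -⟩ := erasureProb_mem_Icc hz n (i / 2 / 2 ^ t)
    have h := ih (i / 2)
    rw [← add_assoc, goodSteps, erasureProb, pow_succ' (2 : ℕ) t, ← Nat.div_div_eq_div_mul,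
      pow_succ' (2 : ℝ) t, mul_assoc]
    set y := (2 : ℝ) ^ t * erasureProb z n (i / 2 / 2 ^ t)
    have hy : 0 ≤ y := by positivity
    split_ifs with hi
    · rw [hi, add_zero, mul_pow]
      have h2 : (2 : ℝ) ≤ 2 ^ 2 ^ goodSteps t (i / 2) := by
        simpa using pow_le_pow_right₀ (one_le_two (α := ℝ))
          (Nat.one_le_two_pow (n := goodSteps t (i / 2)))
      have := mul_le_mul h2 h h0 (by positivity)
      nlinarith
    · rw [Nat.mod_two_ne_zero.1 hi, pow_succ 2, pow_mul]
      refine pow_le_pow_left₀ h0 (h.trans (pow_le_pow_left₀ hy (by linarith) _)) 2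

/-! ### Block errors -/

/-- The weight of the set `S` of erased copies among `N`. -/
noncomputable def erasureWeight (z : ℝ) (N : ℕ) (S : Finset ℕ) : ℝ :=
  z ^ S.card * (1 - z) ^ (N - S.card)

theorem erasureWeight_nonneg {z : ℝ} (hz : z ∈ Set.Icc (0 : ℝ) 1) (N : ℕ) (S : Finset ℕ) :
    0 ≤ erasureWeight z N S :=
  mul_nonneg (pow_nonneg hz.1 _) (pow_nonneg (sub_nonneg.2 hz.2) _)

theorem sum_erasureWeight (z : ℝ) (N : ℕ) :
    ∑ S ∈ (Finset.range N).powerset, erasureWeight z N S = 1 := by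
  have := Finset.sum_pow_mul_eq_add_pow z (1 - z) (Finset.range N)
  simpa [erasureWeight] using this

/-- Together with `erasureWeight_union` this is the independence of disjoint blocks of copies. -/
theorem sum_powerset_range_add (a b : ℕ) (F : Finset ℕ → ℝ) :
    ∑ S ∈ (Finset.range (a + b)).powerset, F S =
      ∑ S ∈ (Finset.range a).powerset, ∑ T ∈ (Finset.range b).powerset,
        F (S ∪ T.map (addLeftEmbedding a)) := by
  induction b generalizing F with
  | zero => simp
  | succ b ih =>
    rw [← add_assoc, Finset.range_add_one, Finset.sum_powerset_insert (by simp), ih,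
      ih fun S => F (insert (a + b) S), ← Finset.sum_add_distrib]
    refine Finset.sum_congr rfl fun S _ => ?_
    rw [Finset.range_add_one, Finset.sum_powerset_insert (by simp)]
    simp [Finset.map_insert]

theorem erasureWeight_union (z : ℝ) {a b : ℕ} {S T : Finset ℕ} (hS : S ⊆ Finset.range a)
    (hT : T ⊆ Finset.range b) :
    erasureWeight z (a + b) (S ∪ T.map (addLeftEmbedding a)) =
      erasureWeight z a S * erasureWeight z b T := by
  have hd : Disjoint S (T.map (addLeftEmbedding a)) := by
    rw [Finset.disjoint_left]
    intro k hk hk'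
    obtain ⟨l, -, rfl⟩ := Finset.mem_map.1 hk'
    have := Finset.mem_range.1 (hS hk)
    simp at this
  have h1 : S.card ≤ a := by simpa using Finset.card_le_card hS
  have h2 : T.card ≤ b := by simpa using Finset.card_le_card hT
  have h3 : a + b - (S.card + T.card) = (a - S.card) + (b - T.card) := by omega
  rw [erasureWeight, erasureWeight, erasureWeight, Finset.card_union_of_disjoint hd,
    Finset.card_map, h3, pow_add, pow_add]
  ring

theorem synthErased_congr (n i : ℕ) {e e' : ℕ → Prop} (h : ∀ k < 2 ^ n, (e k ↔ e' k)) :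
    synthErased n i e ↔ synthErased n i e' := by
  induction n generalizing i e e' with
  | zero => exact h 0 (by simp)
  | succ n ih =>
    have hp : 2 ^ (n + 1) = 2 ^ n + 2 ^ n := by ring
    have h1 := ih (i / 2) (e := e) (e' := e') fun k hk => h k (by omega)
    have h2 := ih (i / 2) (e := fun k => e (2 ^ n + k)) (e' := fun k => e' (2 ^ n + k))
      fun k hk => h _ (by omega)
    simp only [synthErased, h1, h2]

open Classical in
theorem sum_synthErased (z : ℝ) (n i : ℕ) :
    ∑ S ∈ (Finset.range (2 ^ n)).powerset,
      (if synthErased n i (fun k => k ∈ S) then erasureWeight z (2 ^ n) S else 0) =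
      erasureProb z n i := by
  induction n generalizing i with
  | zero =>
    have : Finset.range (2 ^ 0) = insert 0 ∅ := by ext; simp
    rw [this, Finset.sum_powerset_insert (by simp)]
    simp [synthErased, erasureWeight, erasureProb]
  | succ n ih =>
    set W := erasureWeight z (2 ^ n)
    set X : Finset ℕ → ℝ := fun S =>
      if synthErased n (i / 2) (fun k => k ∈ S) then W S else 0
    have hX : ∑ S ∈ (Finset.range (2 ^ n)).powerset, X S = erasureProb z n (i / 2) := ih (i / 2)
    have hW : ∑ S ∈ (Finset.range (2 ^ n)).powerset, W S = 1 := sum_erasureWeight z _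
    have key : ∀ S ∈ (Finset.range (2 ^ n)).powerset, ∀ T ∈ (Finset.range (2 ^ n)).powerset,
        (if synthErased (n + 1) i (fun k => k ∈ S ∪ T.map (addLeftEmbedding (2 ^ n)))
          then erasureWeight z (2 ^ n + 2 ^ n) (S ∪ T.map (addLeftEmbedding (2 ^ n))) else 0) =
        -- Inclusion–exclusion for "at least one copy erases", a product for "both erase".
        if i % 2 = 0 then X S * W T + W S * X T - X S * X T else X S * X T := by
      intro S hS T hT
      rw [Finset.mem_powerset] at hS hT
      rw [erasureWeight_union z hS hT]
      have h1 : synthErased n (i / 2) (fun k => k ∈ S ∪ T.map (addLeftEmbedding (2 ^ n))) ↔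
          synthErased n (i / 2) (fun k => k ∈ S) := by
        refine synthErased_congr n _ fun k hk => ?_
        simp only [Finset.mem_union, Finset.mem_map, addLeftEmbedding_apply]
        refine or_iff_left ?_
        rintro ⟨l, -, hl⟩
        omega
      have h2 : synthErased n (i / 2)
          (fun k => 2 ^ n + k ∈ S ∪ T.map (addLeftEmbedding (2 ^ n))) ↔
          synthErased n (i / 2) (fun k => k ∈ T) := by
        refine synthErased_congr n _ fun k hk => ?_
        simp only [Finset.mem_union, Finset.mem_map, addLeftEmbedding_apply, add_right_inj,
          exists_eq_right]
        refine or_iff_right fun h => ?_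
        have := Finset.mem_range.1 (hS h)
        omega
      simp only [synthErased, h1, h2, X, W]
      by_cases hi : i % 2 = 0 <;>
      by_cases hs : synthErased n (i / 2) (fun k => k ∈ S) <;>
      by_cases ht : synthErased n (i / 2) (fun k => k ∈ T) <;> simp [hi, hs, ht]
    rw [show 2 ^ (n + 1) = 2 ^ n + 2 ^ n by ring, sum_powerset_range_add,
      Finset.sum_congr rfl fun S hS => Finset.sum_congr rfl fun T hT => key S hS T hT, erasureProb]
    split_ifs
    · simp only [Finset.sum_add_distrib, Finset.sum_sub_distrib, ← Finset.sum_mul_sum, hX, hW]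
      ring
    · rw [← Finset.sum_mul_sum, hX, sq]

theorem blockError_le_sum {z : ℝ} (hz : z ∈ Set.Icc (0 : ℝ) 1) {n : ℕ} (A : Code n) :
    blockError z A ≤ ∑ i ∈ A, erasureProb z n i := by
  classical
  simp_rw [← sum_synthErased z n]
  rw [Finset.sum_comm, blockError]
  refine Finset.sum_le_sum fun S _ => ?_
  have h0 := erasureWeight_nonneg hz (2 ^ n) S
  have hpos : ∀ i ∈ A, (0 : ℝ) ≤
      if synthErased n i (fun k => k ∈ S) then erasureWeight z (2 ^ n) S else 0 := fun i _ => by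
    split_ifs <;> simp [h0]
  split_ifs with h
  · obtain ⟨i, hi, he⟩ := h
    refine le_trans ?_ (Finset.single_le_sum hpos hi)
    rw [if_pos he, erasureWeight]
  · exact Finset.sum_nonneg hpos

theorem erasureProb_le_blockError {z : ℝ} (hz : z ∈ Set.Icc (0 : ℝ) 1) {n : ℕ} {A : Code n}
    {i : Fin (2 ^ n)} (hi : i ∈ A) : erasureProb z n i ≤ blockError z A := by
  classical
  rw [← sum_synthErased z n, blockError]
  refine Finset.sum_le_sum fun S _ => ?_
  have h0 := erasureWeight_nonneg hz (2 ^ n) S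
  by_cases he : synthErased n i (fun k => k ∈ S)
  · rw [if_pos he, if_pos ⟨i, hi, he⟩, erasureWeight]
  · rw [if_neg he]
    split_ifs
    exacts [h0, le_rfl]

theorem blockError_le_one {z : ℝ} (hz : z ∈ Set.Icc (0 : ℝ) 1) {n : ℕ} (A : Code n) :
    blockError z A ≤ 1 := by
  rw [← sum_erasureWeight z (2 ^ n), blockError]
  refine Finset.sum_le_sum fun S _ => ?_
  have h0 := erasureWeight_nonneg hz (2 ^ n) S
  split_ifs
  exacts [le_rfl, h0]

/-! ### Binary entropy -/

theorem H₂_zero : H₂ 0 = 0 := by simp [H₂]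

theorem H₂_half : H₂ (1 / 2) = 1 := by
  have : Real.log 2 ≠ 0 := (Real.log_pos one_lt_two).ne'
  rw [H₂, one_div, Real.binEntropy_two_inv, div_self this]

theorem H₂_continuous : Continuous H₂ := Real.binEntropy_continuous.div_const _

theorem H₂_strictMonoOn : StrictMonoOn H₂ (Set.Icc 0 (1 / 2)) := by
  intro a ha b hb hab
  rw [one_div] at ha hb
  exact div_lt_div_of_pos_right (Real.binEntropy_strictMonoOn ha hb hab)
    (Real.log_pos one_lt_two)

theorem exists_H₂_eq {y : ℝ} (hy : y ∈ Set.Icc (0 : ℝ) 1) :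
    ∃ p ∈ Set.Icc (0 : ℝ) (1 / 2), H₂ p = y := by
  have h := intermediate_value_Icc (by norm_num : (0 : ℝ) ≤ 1 / 2) H₂_continuous.continuousOn
  rw [H₂_zero, H₂_half] at h
  exact h hy

theorem H₂inv_mem {y : ℝ} (hy : y ∈ Set.Icc (0 : ℝ) 1) : H₂inv y ∈ Set.Icc (0 : ℝ) (1 / 2) :=
  Function.invFunOn_mem (exists_H₂_eq hy)

theorem H₂_H₂inv {y : ℝ} (hy : y ∈ Set.Icc (0 : ℝ) 1) : H₂ (H₂inv y) = y :=
  Function.invFunOn_eq (exists_H₂_eq hy)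

theorem H₂inv_pos {y : ℝ} (h0 : 0 < y) (h1 : y ≤ 1) : 0 < H₂inv y := by
  refine (H₂inv_mem ⟨h0.le, h1⟩).1.lt_of_ne fun h => ?_
  have := H₂_H₂inv ⟨h0.le, h1⟩
  rw [← h, H₂_zero] at this
  exact h0.ne this

theorem tendsto_H₂inv : Tendsto H₂inv (𝓝[<] 1) (𝓝 (1 / 2)) := by
  rw [tendsto_order]
  have hIoo : ∀ b : ℝ, b < 1 → ∀ᶠ y in 𝓝[<] (1 : ℝ), y ∈ Set.Ioo b 1 := fun b hb =>
    Ioo_mem_nhdsLT hb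
  constructor
  · intro a ha
    have hb : max a 0 ∈ Set.Icc (0 : ℝ) (1 / 2) :=
      ⟨le_max_right _ _, max_le ha.le (by norm_num)⟩
    have hlt : H₂ (max a 0) < 1 := by
      rw [← H₂_half]
      exact H₂_strictMonoOn hb ⟨by norm_num, le_rfl⟩ (max_lt ha (by norm_num))
    filter_upwards [hIoo _ hlt, hIoo 0 one_pos] with y hy hy0
    have hmem : y ∈ Set.Icc (0 : ℝ) 1 := ⟨hy0.1.le, hy0.2.le⟩
    refine (le_max_left a 0).trans_lt ?_
    rw [← H₂_strictMonoOn.lt_iff_lt hb (H₂inv_mem hmem), H₂_H₂inv hmem]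
    exact hy.1
  · intro a ha
    filter_upwards [hIoo 0 one_pos] with y hy
    exact (H₂inv_mem ⟨hy.1.le, hy.2.le⟩).2.trans_lt ha

/-! ### The parametrized pair: the main condition and the limit as `γ → 1`. -/

section Parameters

variable {μs γ : ℝ}

theorem entropyArg_eq (hμ : 0 < μs) (hγ : 0 < γ) :
    (γ * (μs + 1) - 1) / (γ * μs) = 1 - (1 - γ) / (γ * μs) := by
  field_simp; ring

theorem entropyArg_mem (hμ : 0 < μs) (hγ : 1 / (1 + μs) < γ) (hγ1 : γ < 1) :
    (γ * (μs + 1) - 1) / (γ * μs) ∈ Set.Ioo (0 : ℝ) 1 := by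
  have hγ0 : 0 < γ := lt_trans (by positivity) hγ
  rw [div_lt_iff₀ (by positivity)] at hγ
  constructor
  · exact div_pos (by linarith) (by positivity)
  · rw [div_lt_one (by positivity)]; linarith

/-- With `s = γ / (1 - (1 - γ) * π)`, which lies in `[γ, 1]`, the left-hand side becomes `(1 - s) /
μs + H₂ (s * p)`. This is at most `(1 - γ) / μs + H₂ p`, whereas `1 - H₂ p = (1 - γ) / (γ * μs)` is
strictly larger than the first summand. -/
theorem mainCondition (hμ : 2 < μs) (hγ : 1 / (1 + μs) < γ) (hγ1 : γ < 1) :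
    MainCondition μs (betaOf μs γ) (muOf μs γ) := by
  intro π hπ
  have hμ0 : 0 < μs := by linarith
  have hγ0 : 0 < γ := lt_trans (by positivity) hγ
  have h1γ : 0 < 1 - γ := by linarith
  have hy := entropyArg_mem hμ0 hγ hγ1
  have hyI : (γ * (μs + 1) - 1) / (γ * μs) ∈ Set.Icc (0 : ℝ) 1 := ⟨hy.1.le, hy.2.le⟩
  have hp := H₂inv_mem hyI
  have hHp := H₂_H₂inv hyI
  rw [betaOf, muOf]
  set p := H₂inv ((γ * (μs + 1) - 1) / (γ * μs))
  have ht0 : 0 < 1 - (1 - γ) * π := by nlinarith [hπ.1, hπ.2]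
  have htγ : γ ≤ 1 - (1 - γ) * π := by nlinarith [hπ.1, hπ.2]
  set t := 1 - (1 - γ) * π with ht
  have hden : μs / (1 - γ) - μs * π = μs * t / (1 - γ) := by
    rw [ht]; field_simp
  have e1 : (1 - π) / (μs * t / (1 - γ)) = (1 - γ / t) / μs := by
    field_simp
    rw [ht]; ring
  have e2 : γ * p * (μs / (1 - γ)) / (μs * t / (1 - γ)) = γ / t * p := by
    field_simp
  rw [hden, e1, e2]
  have hs1 : γ / t ≤ 1 := (div_le_one ht0).2 htγ
  have hs0 : 0 < γ / t := div_pos hγ0 ht0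
  have hsγ : γ ≤ γ / t := by
    rw [le_div_iff₀ ht0]
    nlinarith [hπ.1, mul_nonneg h1γ.le hπ.1]
  have hsp : γ / t * p ≤ p := mul_le_of_le_one_left hp.1 hs1
  have hH : H₂ (γ / t * p) ≤ H₂ p :=
    H₂_strictMonoOn.monotoneOn ⟨mul_nonneg hs0.le hp.1, hsp.trans hp.2⟩ hp hsp
  have h2 : (1 - γ / t) / μs ≤ (1 - γ) / μs := by gcongr
  have h3 : (1 - γ) / μs < (1 - γ) / (γ * μs) := by
    apply div_lt_div_of_pos_left h1γ (by positivity)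
    nlinarith
  rw [hHp, entropyArg_eq hμ0 hγ0] at hH
  linarith

theorem tendsto_betaOf (hμ : 0 < μs) :
    Tendsto (fun γ : ℝ => betaOf μs γ) (𝓝[<] 1) (𝓝 (1 / 2)) := by
  have h1 : Tendsto (fun γ : ℝ => (γ * (μs + 1) - 1) / (γ * μs)) (𝓝[<] 1) (𝓝[<] 1) := by
    refine tendsto_nhdsWithin_iff.2 ⟨?_, ?_⟩
    · have : ContinuousAt (fun γ : ℝ => (γ * (μs + 1) - 1) / (γ * μs)) 1 := by
        refine ContinuousAt.div (by fun_prop) (by fun_prop) (by simpa using hμ.ne')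
      have h := this.tendsto
      simp only [one_mul, add_sub_cancel_right, div_self hμ.ne'] at h
      exact h.mono_left nhdsWithin_le_nhds
    · have hlt : 1 / (1 + μs) < 1 := by rw [div_lt_one] <;> linarith
      filter_upwards [Ioo_mem_nhdsLT hlt] with γ hγ
      exact (entropyArg_mem hμ hγ.1 hγ.2).2
  have h2 : Tendsto (fun γ : ℝ => γ) (𝓝[<] 1) (𝓝 1) := nhdsWithin_le_nhds
  simpa [betaOf] using h2.mul (tendsto_H₂inv.comp h1)

end Parameters

/-! ### The tail of the number of squaring steps -/

/-- `p / (1 - p)` is the optimal tilt in the Chernoff bound; at this value the bound is exactly the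
entropy. -/
theorem one_add_div_eq {p : ℝ} (h0 : 0 < p) (h1 : p < 1) :
    1 + p / (1 - p) = (2 : ℝ) ^ H₂ p * (p / (1 - p)) ^ p := by
  have h1' : 0 < 1 - p := by linarith
  have hl : Real.log 2 ≠ 0 := (Real.log_pos one_lt_two).ne'
  have e : 1 + p / (1 - p) = Real.exp (-Real.log (1 - p)) := by
    rw [Real.exp_neg, Real.exp_log h1']; field_simp; ring
  rw [e, Real.rpow_def_of_pos two_pos, Real.rpow_def_of_pos (div_pos h0 h1'), ← Real.exp_add,
    Real.log_div h0.ne' h1'.ne', H₂, mul_div_cancel₀ _ hl, Real.binEntropy, Real.log_inv,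
    Real.log_inv]
  congr 1; ring

theorem card_goodSteps_le {p : ℝ} (h0 : 0 < p) (h1 : p ≤ 1 / 2) (n t : ℕ) :
    (((Finset.range (2 ^ (n + t))).filter fun i => (goodSteps t i : ℝ) ≤ p * t).card : ℝ) ≤
      2 ^ n * (2 : ℝ) ^ (t * H₂ p) := by
  have h1' : 0 < 1 - p := by linarith
  set lam := p / (1 - p) with hlam
  have hl0 : 0 < lam := div_pos h0 h1'
  have hl1 : lam ≤ 1 := (div_le_one h1').2 (by linarith)
  have hpow : 0 < lam ^ (p * t) := Real.rpow_pos_of_pos hl0 _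
  refine le_of_mul_le_mul_right ?_ hpow
  calc (((Finset.range (2 ^ (n + t))).filter fun i => (goodSteps t i : ℝ) ≤ p * t).card : ℝ) *
        lam ^ (p * t)
      = ∑ i ∈ (Finset.range (2 ^ (n + t))).filter (fun i => (goodSteps t i : ℝ) ≤ p * t),
          lam ^ (p * t) := by rw [Finset.sum_const, nsmul_eq_mul]
    _ ≤ ∑ i ∈ (Finset.range (2 ^ (n + t))).filter (fun i => (goodSteps t i : ℝ) ≤ p * t),
          lam ^ goodSteps t i := by
        refine Finset.sum_le_sum fun i hi => ?_
        rw [← Real.rpow_natCast]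
        exact Real.rpow_le_rpow_of_exponent_ge hl0 hl1 (Finset.mem_filter.1 hi).2
    _ ≤ ∑ i ∈ Finset.range (2 ^ (n + t)), lam ^ goodSteps t i :=
        Finset.sum_le_sum_of_subset_of_nonneg (Finset.filter_subset _ _)
          fun i _ _ => (pow_pos hl0 _).le
    _ = 2 ^ n * (2 : ℝ) ^ (t * H₂ p) * lam ^ (p * t) := by
        rw [sum_pow_goodSteps, one_add_div_eq h0 (by linarith), mul_pow, ← Real.rpow_natCast _ t,
          ← Real.rpow_natCast _ t, ← Real.rpow_mul two_pos.le, ← Real.rpow_mul hl0.le, ← mul_assoc,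
          mul_comm (H₂ p)]

/-! ### Polarization -/

/-- Here `u`, `v`, `w` stand for `h` at the two children and at `ξ`. Near an endpoint one of the two
growth factors of `(ξ * (1 - ξ)) ^ α` is tiny, so this term contracts by itself. On `[a, 1 - a]` it
may grow, but `w ≥ m` there and the slack `c - c₀` in the contraction of `h` absorbs it. -/
theorem perturbed_contraction {α c c₀ a m δ ξ u v w : ℝ} (hξ0 : 0 < ξ) (hξ1 : ξ < 1) (hα0 : 0 < α)
    (hc0 : 0 < c) (hcc : c₀ < c) (hδ0 : 0 < δ) (hδ : δ ≤ (c - c₀) * m / 2) (hα3 : (2 : ℝ) ^ α ≤ 2)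
    (ha : (2 * a) ^ α ≤ 2 * c - 2 ^ α) (hh : 0 < w) (hm : a ≤ ξ → ξ ≤ 1 - a → m ≤ w)
    (hs : u + v ≤ c₀ * (2 * w)) :
    (u + δ * (ξ ^ 2 * (1 - ξ ^ 2)) ^ α) +
        (v + δ * ((2 * ξ - ξ ^ 2) * (1 - (2 * ξ - ξ ^ 2))) ^ α) ≤
      2 * c * (w + δ * (ξ * (1 - ξ)) ^ α) := by
  have h1ξ : 0 < 1 - ξ := by linarith
  have hf0 : 0 < ξ * (1 - ξ) := mul_pos hξ0 h1ξ
  have e1 : (ξ ^ 2 * (1 - ξ ^ 2)) ^ α = (ξ * (1 - ξ)) ^ α * (ξ * (1 + ξ)) ^ α := by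
    rw [← Real.mul_rpow hf0.le (by positivity)]; congr 1; ring
  have e2 : ((2 * ξ - ξ ^ 2) * (1 - (2 * ξ - ξ ^ 2))) ^ α =
      (ξ * (1 - ξ)) ^ α * ((2 - ξ) * (1 - ξ)) ^ α := by
    rw [← Real.mul_rpow hf0.le (mul_nonneg (by linarith) h1ξ.le)]; congr 1; ring
  rw [e1, e2]
  set f := (ξ * (1 - ξ)) ^ α
  have hf : 0 < f := Real.rpow_pos_of_pos hf0 α
  have hf1 : f ≤ 1 := Real.rpow_le_one hf0.le (by nlinarith) hα0.le
  have b1 : (ξ * (1 + ξ)) ^ α ≤ 2 ^ α :=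
    Real.rpow_le_rpow (by positivity) (by nlinarith) hα0.le
  have b2 : ((2 - ξ) * (1 - ξ)) ^ α ≤ 2 ^ α :=
    Real.rpow_le_rpow (mul_nonneg (by linarith) h1ξ.le) (by nlinarith) hα0.le
  have hδf : 0 < δ * f := mul_pos hδ0 hf
  have hends : (ξ * (1 + ξ)) ^ α + ((2 - ξ) * (1 - ξ)) ^ α ≤ 2 * c →
      u + δ * (f * (ξ * (1 + ξ)) ^ α) +
        (v + δ * (f * ((2 - ξ) * (1 - ξ)) ^ α)) ≤ 2 * c * (w + δ * f) := by
    intro hr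
    have := mul_le_mul_of_nonneg_left hr hδf.le
    linear_combination hs + this + 2 * mul_pos (sub_pos.2 hcc) hh
  rcases le_or_gt a ξ with hl | hl
  · rcases le_or_gt ξ (1 - a) with hu | hu
    · have hmw := hm hl hu
      have h3 : δ * f * ((ξ * (1 + ξ)) ^ α + ((2 - ξ) * (1 - ξ)) ^ α) ≤ δ * f * 4 :=
        mul_le_mul_of_nonneg_left (by linarith) hδf.le
      have h4 : δ * f * 4 ≤ 2 * (c - c₀) * m := by
        have : δ * f ≤ δ := mul_le_of_le_one_right hδ0.le hf1
        linarith
      have h5 : 2 * (c - c₀) * m ≤ 2 * (c - c₀) * w :=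
        mul_le_mul_of_nonneg_left hmw (by linarith)
      have h6 : 0 < c * (δ * f) := mul_pos hc0 hδf
      linear_combination hs + h3 + h4 + h5 + 2 * h6
    · refine hends ?_
      have : ((2 - ξ) * (1 - ξ)) ^ α ≤ (2 * a) ^ α :=
        Real.rpow_le_rpow (mul_nonneg (by linarith) h1ξ.le) (by nlinarith) hα0.le
      linarith
  · refine hends ?_
    have : (ξ * (1 + ξ)) ^ α ≤ (2 * a) ^ α :=
      Real.rpow_le_rpow (by positivity) (by nlinarith) hα0.le
    linarith

/-- A function with contraction ratio below `2 ^ (-1 / μs)` may be perturbed by a small multiple of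
a small power of `x * (1 - x)`, which bounds it from below near `0` and `1`. -/
theorem EigenCondition.exists_perturbation {h : ℝ → ℝ} {μs : ℝ} (H : EigenCondition h μs)
    (K : ℝ) :
    ∃ α > 0, ∃ δ > 0, ∃ c > 0, (2 : ℝ) ^ (α * K) * c ≤ 2 ^ (-1 / μs) ∧
      ∀ ξ ∈ Set.Icc (0 : ℝ) 1,
        (h (ξ ^ 2) + δ * (ξ ^ 2 * (1 - ξ ^ 2)) ^ α) +
          (h (2 * ξ - ξ ^ 2) + δ * ((2 * ξ - ξ ^ 2) * (1 - (2 * ξ - ξ ^ 2))) ^ α) ≤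
        2 * c * (h ξ + δ * (ξ * (1 - ξ)) ^ α) := by
  obtain ⟨c₀, hc₀, hsup⟩ := H.sup_lt
  have hμ := H.two_lt
  set ρ := (2 : ℝ) ^ (-1 / μs)
  -- This is where `μs > 2` enters: `c` can exceed `2 ^ (-1 / 2)`, hence `2 ^ α / 2` for `α < 1 /
  -- 2`, which leaves room for contraction at the endpoints.
  have hρ : (2 : ℝ) ^ (-1 / 2 : ℝ) < ρ := by
    apply Real.rpow_lt_rpow_of_exponent_lt one_lt_two
    rw [neg_div, neg_div, neg_lt_neg_iff]
    exact one_div_lt_one_div_of_lt two_pos hμ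
  obtain ⟨c, hc1, hcρ⟩ := exists_between (max_lt hc₀ hρ)
  have hcc : c₀ < c := (le_max_left _ _).trans_lt hc1
  have hc2 : (2 : ℝ) ^ (-1 / 2 : ℝ) < c := (le_max_right _ _).trans_lt hc1
  have hc0 : 0 < c := (Real.rpow_pos_of_pos two_pos _).trans hc2
  have hhalf : ∀ᶠ a in 𝓝[>] (0 : ℝ), a ∈ Set.Ioo (0 : ℝ) (1 / 2) := Ioo_mem_nhdsGT (by norm_num)
  obtain ⟨α, hα0, hα1, hαK⟩ : ∃ α : ℝ, 0 < α ∧ α < 1 / 2 ∧ (2 : ℝ) ^ (α * K) * c < ρ := by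
    have ht : Tendsto (fun α : ℝ => (2 : ℝ) ^ (α * K) * c) (𝓝[>] 0) (𝓝 c) := by
      have : ContinuousAt (fun α : ℝ => (2 : ℝ) ^ (α * K) * c) 0 :=
        ((Real.continuous_const_rpow two_ne_zero).comp (continuous_mul_const K)).mul_const c
          |>.continuousAt
      have h' := this.tendsto
      simp only [zero_mul, Real.rpow_zero, one_mul] at h'
      exact h'.mono_left nhdsWithin_le_nhds
    obtain ⟨α, ⟨h1, h2⟩, h3⟩ :=
      (hhalf.and (ht.eventually_lt_const hcρ)).exists
    exact ⟨α, h1, h2, h3⟩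
  have hα2 : (2 : ℝ) ^ α / 2 < c := by
    refine lt_of_le_of_lt ?_ hc2
    rw [← Real.rpow_sub_one two_ne_zero]
    exact Real.rpow_le_rpow_of_exponent_le one_le_two (by linarith)
  have hα3 : (2 : ℝ) ^ α ≤ 2 := by
    simpa using Real.rpow_le_rpow_of_exponent_le one_le_two (show α ≤ 1 by linarith)
  obtain ⟨a, ha0, ha1, ha⟩ : ∃ a : ℝ, 0 < a ∧ a < 1 / 2 ∧ (2 * a) ^ α < 2 * c - 2 ^ α := by
    have ht : Tendsto (fun a : ℝ => (2 * a) ^ α) (𝓝[>] 0) (𝓝 0) := by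
      have : ContinuousAt (fun a : ℝ => (2 * a) ^ α) 0 :=
        ((Real.continuous_rpow_const hα0.le).comp (continuous_const_mul 2)).continuousAt
      have h' := this.tendsto
      simp only [mul_zero, Real.zero_rpow hα0.ne'] at h'
      exact h'.mono_left nhdsWithin_le_nhds
    obtain ⟨a, ⟨h1, h2⟩, h3⟩ := (hhalf.and
      (ht.eventually_lt_const (show 0 < 2 * c - 2 ^ α by linarith))).exists
    exact ⟨a, h1, h2, h3⟩
  obtain ⟨m, hm0, hm⟩ := H.locally_pos a ⟨ha0, ha1⟩
  refine ⟨α, hα0, (c - c₀) * m / 2, by have := sub_pos.2 hcc; positivity, c, hc0, hαK.le,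
    fun ξ hξ => ?_⟩
  set δ := (c - c₀) * m / 2 with hδ
  have hδ0 : 0 < δ := by have := sub_pos.2 hcc; positivity
  rcases eq_or_lt_of_le hξ.1 with rfl | hξ0
  · simp [H.zero, Real.zero_rpow hα0.ne']
  rcases eq_or_lt_of_le hξ.2 with rfl | hξ1
  · norm_num [H.one, Real.zero_rpow hα0.ne']
  have hh := H.pos ξ ⟨hξ0, hξ1⟩
  have hs := hsup ξ ⟨hξ0, hξ1⟩
  rw [div_le_iff₀ (by positivity)] at hs
  exact perturbed_contraction hξ0 hξ1 hα0 hc0 hcc hδ0 hδ.le hα3 ha.le hh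
    (fun hl hu => hm ξ ⟨hl, hu⟩) hs

theorem sum_le_of_contraction {g : ℝ → ℝ} {c z : ℝ} (hc : 0 ≤ c) (hz : z ∈ Set.Icc (0 : ℝ) 1)
    (hg : ∀ ξ ∈ Set.Icc (0 : ℝ) 1, g (ξ ^ 2) + g (2 * ξ - ξ ^ 2) ≤ c * g ξ) (n : ℕ) :
    ∑ i ∈ Finset.range (2 ^ n), g (erasureProb z n i) ≤ c ^ n * g z := by
  induction n with
  | zero => simp [erasureProb]
  | succ n ih =>
    rw [sum_range_two_pow_succ, pow_succ', mul_assoc]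
    refine le_trans ?_ (mul_le_mul_of_nonneg_left ih hc)
    rw [Finset.mul_sum]
    refine Finset.sum_le_sum fun j _ => ?_
    rw [erasureProb_bit0, erasureProb_bit1, add_comm]
    exact hg _ (erasureProb_mem_Icc hz n j)

/-- All but a fraction `z + O(2 ^ (-n / μs)) + 2 ^ (-(N + 1))` of the channels of depth `n` have
erasure probability at most `2 ^ (-(N + 1))`, where `N` may be linear in `n`. -/
theorem EigenCondition.card_not_reliable_le {h : ℝ → ℝ} {μs : ℝ} (H : EigenCondition h μs)
    (K : ℝ) :
    ∃ C > 0, ∀ z ∈ Set.Icc (0 : ℝ) 1, ∀ n N : ℕ, (N : ℝ) ≤ K * (n + 1) →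
      (((Finset.range (2 ^ n)).filter
        fun i => ¬ erasureProb z n i ≤ (1 / 2 : ℝ) ^ (N + 1)).card : ℝ) ≤
        2 ^ n * (z + C * (2 : ℝ) ^ (-(n : ℝ) / μs) + (1 / 2 : ℝ) ^ (N + 1)) := by
  obtain ⟨α, hα, δ, hδ, c, hc, hcK, hg⟩ := H.exists_perturbation K
  refine ⟨(1 + δ) / δ * 2 ^ (α * (K + 2)), by positivity, fun z hz n N hN => ?_⟩
  set ε := (1 / 2 : ℝ) ^ (N + 1) with hε
  have hε0 : 0 < ε := by positivity
  have hε1 : ε ≤ 1 / 2 := by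
    rw [hε, pow_succ]
    exact mul_le_of_le_one_left (by norm_num) (pow_le_one₀ (by norm_num) (by norm_num))
  set s := Finset.range (2 ^ n) with hs
  set mid := s.filter fun i => ε < erasureProb z n i ∧ erasureProb z n i ≤ 1 - ε
  set high := s.filter fun i => 1 - ε < erasureProb z n i
  have hsplit : ((s.filter fun i => ¬ erasureProb z n i ≤ ε).card : ℝ) ≤ mid.card + high.card := by
    have : (s.filter fun i => ¬ erasureProb z n i ≤ ε) ⊆ mid ∪ high := by
      intro i hi
      rw [Finset.mem_filter, not_le] at hi
      rw [Finset.mem_union, Finset.mem_filter, Finset.mem_filter]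
      rcases le_or_gt (erasureProb z n i) (1 - ε) with h' | h'
      exacts [Or.inl ⟨hi.1, hi.2, h'⟩, Or.inr ⟨hi.1, h'⟩]
    exact_mod_cast (Finset.card_le_card this).trans (Finset.card_union_le _ _)
  -- Markov's inequality for the mean `z`.
  have hhigh : (high.card : ℝ) ≤ 2 ^ n * (z + ε) := by
    have h1 : (high.card : ℝ) * (1 - ε) ≤ 2 ^ n * z := by
      rw [← sum_erasureProb z n, ← nsmul_eq_mul, ← Finset.sum_const]
      exact (Finset.sum_le_sum fun i hi => (Finset.mem_filter.1 hi).2.le).trans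
        (Finset.sum_le_sum_of_subset_of_nonneg (Finset.filter_subset _ _)
          fun i _ _ => (erasureProb_mem_Icc hz n i).1)
    have h2 : (high.card : ℝ) ≤ 2 ^ n := by
      have := Finset.card_filter_le s fun i => 1 - ε < erasureProb z n i
      rw [hs, Finset.card_range] at this
      exact_mod_cast this
    nlinarith
  -- Markov's inequality for the perturbed `h`, which is at least `δ * (ε / 2) ^ α` here. The choice
  -- of `α` makes this loss, exponential in `n`, fit between `c` and `2 ^ (-1 / μs)`.
  have hmid : (mid.card : ℝ) ≤
      2 ^ n * ((1 + δ) / δ * 2 ^ (α * (K + 2)) * (2 : ℝ) ^ (-(n : ℝ) / μs)) := by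
    have hg0 : ∀ x ∈ Set.Icc (0 : ℝ) 1, 0 ≤ h x ∧ 0 ≤ (x * (1 - x)) ^ α := fun x hx =>
      ⟨(H.mapsTo hx).1, Real.rpow_nonneg (mul_nonneg hx.1 (sub_nonneg.2 hx.2)) _⟩
    have h1 : (mid.card : ℝ) * (δ * (ε / 2) ^ α) ≤
        (2 * c) ^ n * (h z + δ * (z * (1 - z)) ^ α) := by
      refine le_trans ?_ (sum_le_of_contraction (g := fun x => h x + δ * (x * (1 - x)) ^ α)
        (by positivity) hz hg n)
      rw [← nsmul_eq_mul, ← Finset.sum_const]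
      refine (Finset.sum_le_sum fun i hi => ?_).trans
        (Finset.sum_le_sum_of_subset_of_nonneg (Finset.filter_subset _ _) fun i _ _ => ?_)
      · have hx := hg0 _ (erasureProb_mem_Icc hz n i)
        obtain ⟨-, hl, hu⟩ := Finset.mem_filter.1 hi
        have : (ε / 2) ^ α ≤ (erasureProb z n i * (1 - erasureProb z n i)) ^ α :=
          Real.rpow_le_rpow (by positivity) (by nlinarith) hα.le
        have := mul_le_mul_of_nonneg_left this hδ.le
        linarith
      · have hx := hg0 _ (erasureProb_mem_Icc hz n i)
        have := mul_nonneg hδ.le hx.2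
        linarith
    have h2 : h z + δ * (z * (1 - z)) ^ α ≤ 1 + δ := by
      have : (z * (1 - z)) ^ α ≤ 1 :=
        Real.rpow_le_one (mul_nonneg hz.1 (sub_nonneg.2 hz.2)) (by nlinarith [hz.1, hz.2]) hα.le
      have := mul_le_mul_of_nonneg_left this hδ.le
      linarith [(H.mapsTo hz).2]
    have h3 : (ε / 2) ^ α = (2 : ℝ) ^ (-(α * (N + 2))) := by
      have : ε / 2 = (2 : ℝ) ^ (-((N : ℝ) + 2)) := by
        rw [show (N : ℝ) + 2 = ((N + 2 : ℕ) : ℝ) by push_cast; ring, Real.rpow_neg two_pos.le,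
          Real.rpow_natCast, pow_succ _ (N + 1), mul_inv, hε, one_div, inv_pow, div_eq_mul_inv]
      rw [this, ← Real.rpow_mul two_pos.le]; congr 1; ring
    have h4 : (2 : ℝ) ^ (α * (N + 2)) * c ^ n ≤
        2 ^ (α * (K + 2)) * (2 : ℝ) ^ (-(n : ℝ) / μs) := by
      have h5 : (2 : ℝ) ^ (α * ((N : ℝ) + 2)) ≤ 2 ^ (α * (K + 2)) * ((2 : ℝ) ^ (α * K)) ^ n := by
        rw [← Real.rpow_natCast, ← Real.rpow_mul two_pos.le, ← Real.rpow_add two_pos]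
        apply Real.rpow_le_rpow_of_exponent_le one_le_two
        nlinarith
      have h6 : ((2 : ℝ) ^ (α * K) * c) ^ n ≤ (2 : ℝ) ^ (-(n : ℝ) / μs) := by
        refine (pow_le_pow_left₀ (by positivity) hcK n).trans_eq ?_
        rw [← Real.rpow_natCast, ← Real.rpow_mul two_pos.le]; congr 1; ring
      calc _ ≤ 2 ^ (α * (K + 2)) * ((2 : ℝ) ^ (α * K)) ^ n * c ^ n := by gcongr
        _ = 2 ^ (α * (K + 2)) * ((2 : ℝ) ^ (α * K) * c) ^ n := by rw [mul_pow]; ring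
        _ ≤ _ := by gcongr
    have h7 : (mid.card : ℝ) * δ ≤ 2 ^ n * (1 + δ) * (2 ^ (α * (N + 2)) * c ^ n) := by
      have h8 : (mid.card : ℝ) * (δ * (2 : ℝ) ^ (-(α * (N + 2)))) ≤ (2 * c) ^ n * (1 + δ) := by
        rw [← h3]
        exact h1.trans (mul_le_mul_of_nonneg_left h2 (by positivity))
      have h9 : (2 : ℝ) ^ (-(α * ((N : ℝ) + 2))) * 2 ^ (α * ((N : ℝ) + 2)) = 1 := by
        rw [← Real.rpow_add two_pos]; simp
      have := mul_le_mul_of_nonneg_right h8 (show (0 : ℝ) ≤ 2 ^ (α * ((N : ℝ) + 2)) by positivity)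
      calc (mid.card : ℝ) * δ
          = mid.card * (δ * (2 : ℝ) ^ (-(α * ((N : ℝ) + 2)))) * 2 ^ (α * ((N : ℝ) + 2)) := by
            rw [mul_assoc, mul_assoc δ, h9, mul_one]
        _ ≤ _ := this
        _ = _ := by rw [mul_pow]; ring
    have h10 := h7.trans (mul_le_mul_of_nonneg_left h4 (by positivity))
    rw [← le_div_iff₀ hδ] at h10
    refine h10.trans_eq ?_
    ring
  linarith

/-! ### Achievability -/

/-- The code of all channels with erasure probability at most `θ`. -/
noncomputable def thresholdCode (z : ℝ) (n : ℕ) (θ : ℝ) : Code n :=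
  Finset.univ.filter fun i => erasureProb z n i ≤ θ

theorem card_thresholdCode (z : ℝ) (n : ℕ) (θ : ℝ) :
    (thresholdCode z n θ).card =
      ((Finset.range (2 ^ n)).filter fun i => erasureProb z n i ≤ θ).card := by
  classical
  rw [thresholdCode, Finset.card_filter, Finset.card_filter]
  exact Fin.sum_univ_eq_sum_range (fun i => if erasureProb z n i ≤ θ then 1 else 0) (2 ^ n)

theorem blockError_thresholdCode_le {z : ℝ} (hz : z ∈ Set.Icc (0 : ℝ) 1) (n : ℕ) {θ : ℝ}
    (hθ : 0 ≤ θ) : blockError z (thresholdCode z n θ) ≤ 2 ^ n * θ := by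
  refine (blockError_le_sum hz _).trans ((Finset.sum_le_card_nsmul _ _ θ fun i hi =>
    (Finset.mem_filter.1 hi).2).trans ?_)
  rw [nsmul_eq_mul]
  refine mul_le_mul_of_nonneg_right ?_ hθ
  have := Finset.card_le_univ (thresholdCode z n θ)
  rw [Fintype.card_fin] at this
  exact_mod_cast this

/-- Averaging `x ≤ 1 + θ - 1_{x ≤ θ}` gives the bound. It is needed because the `O` in `Achievable`
is two-sided. -/
theorem rate_thresholdCode_le {z : ℝ} (hz : z ∈ Set.Icc (0 : ℝ) 1) (n : ℕ) {θ : ℝ} (hθ : 0 ≤ θ) :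
    rate (thresholdCode z n θ) ≤ capacity z + θ := by
  classical
  have h1 : (2 : ℝ) ^ n * z ≤ ∑ i ∈ Finset.range (2 ^ n),
      (1 + θ - if erasureProb z n i ≤ θ then 1 else 0) := by
    rw [← sum_erasureProb]
    refine Finset.sum_le_sum fun i _ => ?_
    have := (erasureProb_mem_Icc hz n i).2
    split_ifs <;> linarith
  rw [Finset.sum_sub_distrib, Finset.sum_boole, ← card_thresholdCode] at h1
  simp only [Finset.sum_const, Finset.card_range, nsmul_eq_mul, Nat.cast_pow, Nat.cast_ofNat]
    at h1
  rw [rate, capacity, div_le_iff₀ (by positivity)]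
  linarith

theorem eventually_mul_le_two_rpow {β : ℝ} (hβ : 0 < β) (C : ℝ) :
    ∀ᶠ n : ℕ in atTop, C * n ≤ (2 : ℝ) ^ (β * n) := by
  have h1 : (1 : ℝ) < 2 ^ β := Real.one_lt_rpow one_lt_two hβ
  have h := (tendsto_pow_const_div_const_pow_of_one_lt 1 h1).const_mul C
  rw [mul_zero] at h
  filter_upwards [h.eventually_lt_const one_pos] with n hn
  rw [Real.rpow_mul two_pos.le, Real.rpow_natCast]
  rw [pow_one, ← mul_div_assoc, div_lt_one (by positivity)] at hn
  exact hn.le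

theorem EigenCondition.capacity_sub_rate_le {h : ℝ → ℝ} {μs γ : ℝ} (H : EigenCondition h μs)
    (hγ : 1 / (1 + μs) < γ) (hγ1 : γ < 1) :
    ∃ C, ∀ z ∈ Set.Icc (0 : ℝ) 1, ∀ n : ℕ,
      capacity z - rate (thresholdCode z n ((2 : ℝ) ^ (-((2 : ℝ) ^ (betaOf μs γ * n))))) ≤
        C * (2 : ℝ) ^ (-(n : ℝ) / muOf μs γ) := by
  have hμ := H.two_lt
  have hμ0 : 0 < μs := by linarith
  have hγ0 : 0 < γ := lt_trans (by positivity) hγ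
  have h1γ : 0 < 1 - γ := by linarith
  have hy := entropyArg_mem hμ0 hγ hγ1
  have hp := H₂inv_mem ⟨hy.1.le, hy.2.le⟩
  have hp0 := H₂inv_pos hy.1 hy.2.le
  have hHp := H₂_H₂inv ⟨hy.1.le, hy.2.le⟩
  rw [entropyArg_eq hμ0 hγ0] at hHp hp0 hp
  rw [betaOf, muOf, entropyArg_eq hμ0 hγ0]
  set p := H₂inv (1 - (1 - γ) / (γ * μs))
  obtain ⟨C, hC0, hC⟩ := H.card_not_reliable_le (1 / (1 - γ))
  -- The factor `2 ^ (1 / μs)` pays for rounding `t` up, which leaves `m ≥ (1 - γ) * n - 1`; the two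
  -- ones pay for `ε` and for the Chernoff tail.
  refine ⟨C * 2 ^ (1 / μs) + 1 + 1, fun z hz n => ?_⟩
  set t := ⌈γ * n⌉₊
  have htn : t ≤ n := Nat.ceil_le.2 (mul_le_of_le_one_left (Nat.cast_nonneg n) hγ1.le)
  have htγ : γ * n ≤ t := Nat.le_ceil _
  have htγ' : (t : ℝ) < γ * n + 1 := Nat.ceil_lt_add_one (by positivity)
  obtain ⟨m, hm⟩ := Nat.exists_eq_add_of_le' htn
  have hmr : (n : ℝ) = m + t := by exact_mod_cast hm
  have hm1 : (1 - γ) * n ≤ m + 1 := by linarith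
  have hCm := hC z hz m n (by rw [div_mul_eq_mul_div, le_div_iff₀ h1γ]; linarith)
  set ε := (1 / 2 : ℝ) ^ (n + 1) with hε
  set θ := (2 : ℝ) ^ (-((2 : ℝ) ^ (γ * p * n)))
  have hgood : ∀ i, erasureProb z m (i / 2 ^ t) ≤ ε → ¬ ((goodSteps t i : ℝ) ≤ p * t) →
      erasureProb z n i ≤ θ := by
    intro i h1 h2
    rw [hm]
    refine (erasureProb_add_le hz m t i).trans ?_
    have h0 := (erasureProb_mem_Icc hz m (i / 2 ^ t)).1
    have h3 : 2 ^ t * erasureProb z m (i / 2 ^ t) ≤ 1 / 2 := by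
      calc 2 ^ t * erasureProb z m (i / 2 ^ t) ≤ 2 ^ n * (1 / 2 : ℝ) ^ (n + 1) := by
            gcongr; exact one_le_two
        _ = 1 / 2 := by rw [pow_succ, ← mul_assoc, ← mul_pow]; norm_num
    refine (pow_le_pow_left₀ (by positivity) h3 _).trans ?_
    rw [one_div, inv_pow, ← Real.rpow_natCast, ← Real.rpow_neg two_pos.le]
    apply Real.rpow_le_rpow_of_exponent_le one_le_two
    rw [neg_le_neg_iff, Nat.cast_pow, Nat.cast_ofNat, ← Real.rpow_natCast]
    apply Real.rpow_le_rpow_of_exponent_le one_le_two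
    nlinarith [not_le.1 h2]
  -- Union bound: an index outside the code has an unreliable ancestor at depth `m` or too few good
  -- steps afterwards.
  have hcard : (2 : ℝ) ^ n - (thresholdCode z n θ).card ≤
      2 ^ t * (2 ^ m * (z + C * (2 : ℝ) ^ (-(m : ℝ) / μs) + ε)) +
        2 ^ m * (2 : ℝ) ^ (t * H₂ p) := by
    refine le_trans ?_ (add_le_add (mul_le_mul_of_nonneg_left hCm (by positivity))
      (card_goodSteps_le hp0 hp.2 m t))
    rw [card_thresholdCode, ← Finset.sum_boole, ← Finset.sum_boole, ← Finset.sum_boole,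
      ← sum_range_two_pow_add_div (fun i => if ¬ erasureProb z m i ≤ ε then (1 : ℝ) else 0),
      ← Finset.sum_add_distrib, ← hm]
    have : (2 : ℝ) ^ n = ∑ i ∈ Finset.range (2 ^ n), 1 := by simp
    rw [this, ← Finset.sum_sub_distrib]
    refine Finset.sum_le_sum fun i _ => ?_
    have hi := hgood i
    by_cases h1 : erasureProb z m (i / 2 ^ t) ≤ ε
    · by_cases h2 : (goodSteps t i : ℝ) ≤ p * t
      · split_ifs <;> norm_num
      · rw [if_pos (hi h1 h2), if_neg (not_not.2 h1), if_neg h2]; norm_num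
    · split_ifs <;> norm_num
  have hn0 : (0 : ℝ) < 2 ^ n := by positivity
  have hmain : capacity z - rate (thresholdCode z n θ) ≤
      C * (2 : ℝ) ^ (-(m : ℝ) / μs) + ε + (2 : ℝ) ^ (t * (H₂ p - 1)) := by
    have e1 : (2 : ℝ) ^ n = 2 ^ m * 2 ^ t := by rw [hm, pow_add]
    have e2 : (2 : ℝ) ^ (t * (H₂ p - 1)) = 2 ^ (t * H₂ p) / 2 ^ t := by
      rw [mul_sub, mul_one, Real.rpow_sub two_pos, Real.rpow_natCast]
    rw [rate, capacity, e2, sub_le_iff_le_add, ← sub_le_iff_le_add', ← mul_le_mul_iff_right₀ hn0]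
    have e3 : (2 : ℝ) ^ n * ((2 : ℝ) ^ (t * H₂ p) / 2 ^ t) = 2 ^ m * (2 : ℝ) ^ (t * H₂ p) := by
      rw [e1]; field_simp
    have e4 : (2 : ℝ) ^ n * ((thresholdCode z n θ).card / 2 ^ n) = (thresholdCode z n θ).card := by
      rw [mul_comm, div_mul_cancel₀ _ hn0.ne']
    rw [← mul_assoc, mul_comm ((2 : ℝ) ^ t), ← e1] at hcard
    rw [mul_sub, mul_add, e3, e4] at *
    linarith
  have hμ' : -(n : ℝ) / (μs / (1 - γ)) = -((1 - γ) * n) / μs := by field_simp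
  rw [hμ']
  have b1 : (2 : ℝ) ^ (-(m : ℝ) / μs) ≤ 2 ^ (1 / μs) * (2 : ℝ) ^ (-((1 - γ) * n) / μs) := by
    rw [← Real.rpow_add two_pos, ← add_div]
    apply Real.rpow_le_rpow_of_exponent_le one_le_two
    gcongr
    linarith
  have b2 : ε ≤ (2 : ℝ) ^ (-((1 - γ) * n) / μs) := by
    rw [hε, one_div, inv_pow, ← Real.rpow_natCast, ← Real.rpow_neg two_pos.le]
    apply Real.rpow_le_rpow_of_exponent_le one_le_two
    rw [le_div_iff₀ hμ0]
    push_cast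
    nlinarith [(Nat.cast_nonneg n : (0 : ℝ) ≤ n)]
  have b3 : (2 : ℝ) ^ (t * (H₂ p - 1)) ≤ (2 : ℝ) ^ (-((1 - γ) * n) / μs) := by
    apply Real.rpow_le_rpow_of_exponent_le one_le_two
    rw [hHp]
    have : -((1 - γ) * n) / μs = γ * n * (-((1 - γ) / (γ * μs))) := by field_simp
    rw [this, sub_sub_cancel_left]
    have : 0 < (1 - γ) / (γ * μs) := by positivity
    nlinarith
  have := mul_le_mul_of_nonneg_left b1 hC0.le
  linarith

theorem betaOf_pos {μs γ : ℝ} (hμ : 0 < μs) (hγ : 1 / (1 + μs) < γ) (hγ1 : γ < 1) :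
    0 < betaOf μs γ :=
  mul_pos (lt_trans (by positivity) hγ)
    (H₂inv_pos (entropyArg_mem hμ hγ hγ1).1 (entropyArg_mem hμ hγ hγ1).2.le)

theorem EigenCondition.achievable {h : ℝ → ℝ} {μs γ z : ℝ} (H : EigenCondition h μs)
    (hγ : 1 / (1 + μs) < γ) (hγ1 : γ < 1) (hz : z ∈ Set.Icc (0 : ℝ) 1) :
    Achievable z (betaOf μs γ) (muOf μs γ) := by
  have hμ0 : 0 < μs := by linarith [H.two_lt]
  have hβ := betaOf_pos hμ0 hγ hγ1
  refine ⟨fun n => thresholdCode z n ((2 : ℝ) ^ (-((2 : ℝ) ^ (betaOf μs γ * n)))),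
    Eventually.of_forall fun n => blockError_thresholdCode_le hz n (by positivity), ?_⟩
  obtain ⟨C, hC⟩ := H.capacity_sub_rate_le hγ hγ1
  refine IsBigO.of_bound (max C 1) ?_
  filter_upwards [eventually_mul_le_two_rpow hβ (1 / muOf μs γ)] with n hn
  have hpos : (0 : ℝ) < 2 ^ (-(n : ℝ) / muOf μs γ) := by positivity
  rw [Real.norm_eq_abs, Real.norm_eq_abs, abs_of_pos hpos, abs_le]
  constructor
  · have h1 := rate_thresholdCode_le hz n
      (show (0 : ℝ) ≤ 2 ^ (-((2 : ℝ) ^ (betaOf μs γ * n))) by positivity)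
    have h2 : (2 : ℝ) ^ (-((2 : ℝ) ^ (betaOf μs γ * n))) ≤ 2 ^ (-(n : ℝ) / muOf μs γ) := by
      apply Real.rpow_le_rpow_of_exponent_le one_le_two
      rw [neg_div, neg_le_neg_iff, ← one_div_mul_eq_div]
      exact hn
    have h3 := mul_le_mul_of_nonneg_right (le_max_right C 1) hpos.le
    linarith
  · exact (hC z hz n).trans (mul_le_mul_of_nonneg_right (le_max_left C 1) hpos.le)

/-! ### The error exponent -/

/-- With `s = ξ * (1 - ξ)`, the two growth factors have sum `2 - 2 * s` and product `s * (2 + s)`,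
so the square of the sum of their roots is at most 3. The constant `87 / 50` rounds `√3` up, and
`(87 / 100) ^ 5 < 1 / 2` still allows `μs = 5`. -/
theorem sqrt_contraction {ξ : ℝ} (h0 : 0 < ξ) (h1 : ξ < 1) :
    √(ξ ^ 2 * (1 - ξ ^ 2)) + √((2 * ξ - ξ ^ 2) * (1 - (2 * ξ - ξ ^ 2))) ≤
      87 / 100 * (2 * √(ξ * (1 - ξ))) := by
  have h1' : 0 < 1 - ξ := by linarith
  have hf : 0 ≤ ξ * (1 - ξ) := by positivity
  have hp : 0 ≤ ξ * (1 + ξ) := by positivity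
  have hq : 0 ≤ (2 - ξ) * (1 - ξ) := mul_nonneg (by linarith) h1'.le
  have e1 : ξ ^ 2 * (1 - ξ ^ 2) = ξ * (1 - ξ) * (ξ * (1 + ξ)) := by ring
  have e2 : (2 * ξ - ξ ^ 2) * (1 - (2 * ξ - ξ ^ 2)) = ξ * (1 - ξ) * ((2 - ξ) * (1 - ξ)) := by ring
  have hs : ξ * (1 - ξ) ≤ 1 / 4 := by linarith [sq_nonneg (2 * ξ - 1)]
  have hpq : √(ξ * (1 + ξ)) * √((2 - ξ) * (1 - ξ)) ≤ (1 + 2 * (ξ * (1 - ξ))) / 2 := by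
    rw [← Real.sqrt_mul hp]
    refine Real.sqrt_le_iff.2 ⟨by linarith, ?_⟩
    linear_combination hs
  have hsum : √(ξ * (1 + ξ)) + √((2 - ξ) * (1 - ξ)) ≤ 87 / 50 := by
    refine (sq_le_sq₀ (by positivity) (by norm_num)).1 ?_
    have := Real.sq_sqrt hp
    have := Real.sq_sqrt hq
    nlinarith
  rw [e1, e2, Real.sqrt_mul hf, Real.sqrt_mul hf, ← mul_add]
  linarith [mul_le_mul_of_nonneg_left hsum (Real.sqrt_nonneg (ξ * (1 - ξ)))]

theorem eigenCondition_sqrt : EigenCondition (fun x => √(x * (1 - x))) 5 where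
  mapsTo x hx := ⟨Real.sqrt_nonneg _, Real.sqrt_le_one.2 (by nlinarith [hx.1, hx.2])⟩
  zero := by simp
  one := by simp
  pos x hx := Real.sqrt_pos.2 (mul_pos hx.1 (sub_pos.2 hx.2))
  locally_pos a ha :=
    ⟨√(a / 2), Real.sqrt_pos.2 (half_pos ha.1), fun x hx =>
      Real.sqrt_le_sqrt (by nlinarith [ha.1, ha.2, hx.1, hx.2])⟩
  two_lt := by norm_num
  sup_lt := by
    refine ⟨87 / 100, ?_, fun ξ hξ => ?_⟩
    · refine lt_of_pow_lt_pow_left₀ 5 (by positivity) ?_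
      rw [← Real.rpow_natCast (2 ^ _), ← Real.rpow_mul two_pos.le]
      norm_num [Real.rpow_neg_one]
    · have := Real.sqrt_pos.2 (mul_pos hξ.1 (sub_pos.2 hξ.2))
      rw [div_le_iff₀ (by positivity)]
      exact sqrt_contraction hξ.1 hξ.2

/-- Chebyshev's inequality. -/
theorem card_goodSteps_gt_le {b : ℝ} (hb : 1 / 2 < b) {n : ℕ} (hn : 0 < n) :
    (((Finset.range (2 ^ n)).filter fun i => b * n < goodSteps n i).card : ℝ) *
      ((2 * b - 1) ^ 2 * n) ≤ 2 ^ n := by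
  have hn' : (0 : ℝ) < n := Nat.cast_pos.2 hn
  refine le_of_mul_le_mul_right ?_ hn'
  rw [← sum_sq_goodSteps, ← nsmul_eq_mul, smul_mul_assoc, ← Finset.sum_const]
  refine (Finset.sum_le_sum fun i hi => ?_).trans
    (Finset.sum_le_sum_of_subset_of_nonneg (Finset.filter_subset _ _) fun i _ _ => sq_nonneg _)
  have := (Finset.mem_filter.1 hi).2
  rw [mul_assoc, ← sq, ← mul_pow]
  exact pow_le_pow_left₀ (mul_nonneg (by linarith) hn'.le) (by linarith) 2

theorem eventually_exists_goodSteps_le {R b : ℝ} (hR : 0 < R) (hb : 1 / 2 < b)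
    {A : (n : ℕ) → Code n} (hA : ∀ n, R ≤ rate (A n)) :
    ∀ᶠ n : ℕ in atTop, ∃ i ∈ A n, (goodSteps n i : ℝ) ≤ b * n := by
  have hd : 0 < (2 * b - 1) ^ 2 * R := by
    have : 0 < 2 * b - 1 := by linarith
    positivity
  filter_upwards [eventually_gt_atTop 0, tendsto_natCast_atTop_atTop.eventually_gt_atTop
    (1 / ((2 * b - 1) ^ 2 * R))] with n hn hn1
  rw [div_lt_iff₀ hd] at hn1
  by_contra! hcon
  have hcard : (A n).card ≤
      ((Finset.range (2 ^ n)).filter fun i => b * n < goodSteps n i).card := by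
    refine Finset.card_le_card_of_injOn (fun i => (i : ℕ)) (fun i hi => ?_)
      Fin.val_injective.injOn
    exact Finset.mem_coe.2 (Finset.mem_filter.2 ⟨Finset.mem_range.2 i.2, hcon i hi⟩)
  have h1 := card_goodSteps_gt_le hb hn
  have h2 := hA n
  have h2n : (0 : ℝ) < 2 ^ n := by positivity
  rw [rate, le_div_iff₀ h2n] at h2
  have h3 : R * 2 ^ n * ((2 * b - 1) ^ 2 * n) ≤ 2 ^ n := by
    refine (mul_le_mul_of_nonneg_right (h2.trans (Nat.cast_le.2 hcard)) ?_).trans h1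
    positivity
  nlinarith

/-- The `max 0` covers `P = 1`, where `Real.log 0 = 0`. -/
theorem log_neg_log_le {P z : ℝ} {k : ℕ} (hz0 : 0 < z) (hP1 : P ≤ 1) (hP : z ^ 2 ^ k ≤ P) :
    Real.log (-Real.log P) ≤ max 0 (k * Real.log 2 + Real.log (-Real.log z)) := by
  have hzk : 0 < z ^ 2 ^ k := by positivity
  have hP0 : 0 < P := hzk.trans_le hP
  have h1 : -Real.log P ≤ 2 ^ k * -Real.log z := by
    have := Real.log_le_log hzk hP
    rw [Real.log_pow] at this
    push_cast at this
    linarith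
  rcases eq_or_lt_of_le (neg_nonneg.2 (Real.log_nonpos hP0.le hP1)) with h0 | h0
  · rw [← h0, Real.log_zero]; exact le_max_left _ _
  · refine le_max_of_le_right ((Real.log_le_log h0 h1).trans_eq ?_)
    have hk : (0 : ℝ) < 2 ^ k := by positivity
    rw [Real.log_mul hk.ne' (pos_of_mul_pos_right (h0.trans_le h1) hk.le).ne', Real.log_pow]

theorem seqErrorExponent_le {z R : ℝ} (hz : z ∈ Set.Ioo (0 : ℝ) 1) (hR : 0 < R)
    {A : (n : ℕ) → Code n} (hA : ∀ n, R ≤ rate (A n)) :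
    seqErrorExponent z A ≤ ((1 / 2 : ℝ) : EReal) := by
  have hzI : z ∈ Set.Icc (0 : ℝ) 1 := ⟨hz.1.le, hz.2.le⟩
  have hl2 : 0 < Real.log 2 := Real.log_pos one_lt_two
  refine le_of_forall_gt_imp_ge_of_dense fun a ha => ?_
  obtain ⟨b, hb, hba⟩ := EReal.lt_iff_exists_real_btwn.1 ha
  refine le_trans ?_ hba.le
  rw [EReal.coe_lt_coe_iff] at hb
  -- The gap between `b'` and `b` absorbs the constant `log (-log z)`.
  obtain ⟨b', hb'1, hb'2⟩ := exists_between hb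
  refine liminf_le_of_frequently_le' (Eventually.frequently ?_)
  filter_upwards [eventually_exists_goodSteps_le hR hb'1 hA, eventually_gt_atTop 0,
    tendsto_natCast_atTop_atTop.eventually_ge_atTop
      (Real.log (-Real.log z) / ((b - b') * Real.log 2))] with n ⟨i, hi, hgs⟩ hn hL
  have hn' : (0 : ℝ) < n := Nat.cast_pos.2 hn
  rw [div_le_iff₀ (mul_pos (sub_pos.2 hb'2) hl2)] at hL
  rw [EReal.coe_le_coe_iff, Real.log_pow, div_le_iff₀ (by positivity)]
  refine (log_neg_log_le hz.1 (blockError_le_one hzI _)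
    ((pow_two_pow_goodSteps_le hzI n i).trans (erasureProb_le_blockError hzI hi))).trans
    (max_le ?_ ?_)
  · have : 0 < b := by linarith
    positivity
  · have := mul_le_mul_of_nonneg_right hgs hl2.le
    linarith

/-- At `P = 0` the convention `Real.log 0 = 0` would turn an infinite exponent into 0. -/
theorem blockError_pos {z : ℝ} (hz : z ∈ Set.Ioo (0 : ℝ) 1) {n : ℕ} {A : Code n}
    (hA : 0 < rate A) : 0 < blockError z A := by
  have hzI : z ∈ Set.Icc (0 : ℝ) 1 := ⟨hz.1.le, hz.2.le⟩
  obtain ⟨i, hi⟩ : A.Nonempty := by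
    rw [Finset.nonempty_iff_ne_empty]
    rintro rfl
    simp [rate] at hA
  exact (pow_pos hz.1 _).trans_le
    ((pow_two_pow_goodSteps_le hzI n i).trans (erasureProb_le_blockError hzI hi))

theorem rate_univ (n : ℕ) : rate (Finset.univ : Code n) = 1 := by
  simp [rate]

theorem mul_log_two_le_log_neg_log {P b b' : ℝ} {n : ℕ} (hP0 : 0 < P)
    (hP : P ≤ 2 ^ n * (2 : ℝ) ^ (-((2 : ℝ) ^ (b' * n)))) (h1 : 2 * (n : ℝ) ≤ 2 ^ (b' * n))
    (h2 : 2 ≤ (b' - b) * n) : b * n * Real.log 2 ≤ Real.log (-Real.log P) := by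
  -- One factor 2 pays for the prefactor `2 ^ n`, the other for `log 2 > 1 / 2`.
  have h3 : (4 : ℝ) * 2 ^ (b * n) ≤ 2 ^ (b' * n) := by
    have : (4 : ℝ) = 2 ^ (2 : ℝ) := by norm_num
    rw [this, ← Real.rpow_add two_pos]
    exact Real.rpow_le_rpow_of_exponent_le one_le_two (by linarith)
  have h4 : (2 ^ (b' * n) - n) * Real.log 2 ≤ -Real.log P := by
    have := Real.log_le_log hP0 hP
    rw [Real.log_mul (by positivity) (by positivity), Real.log_pow, Real.log_rpow two_pos] at this
    linarith
  have h5 : (2 : ℝ) ^ (b * n) ≤ -Real.log P := by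
    refine le_trans ?_ h4
    have := Real.log_two_gt_d9
    nlinarith
  have h6 := Real.log_le_log (by positivity) h5
  rwa [Real.log_rpow two_pos] at h6

theorem EigenCondition.exists_le_seqErrorExponent {h : ℝ → ℝ} {μs z R b : ℝ}
    (H : EigenCondition h μs) (hz : z ∈ Set.Ioo (0 : ℝ) 1) (hR0 : 0 < R) (hR : R < capacity z)
    (hb : b < 1 / 2) :
    ∃ A : (n : ℕ) → Code n, (∀ n, R ≤ rate (A n)) ∧ (b : EReal) ≤ seqErrorExponent z A := by
  have hzI : z ∈ Set.Icc (0 : ℝ) 1 := ⟨hz.1.le, hz.2.le⟩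
  have hμ0 : 0 < μs := by linarith [H.two_lt]
  have hl2 : 0 < Real.log 2 := Real.log_pos one_lt_two
  have hlt : 1 / (1 + μs) < 1 := by rw [div_lt_one] <;> linarith
  obtain ⟨γ, hbγ, hγ, hγ1⟩ := (((tendsto_betaOf hμ0).eventually_const_lt hb).and
    (show ∀ᶠ γ in 𝓝[<] (1 : ℝ), γ ∈ Set.Ioo (1 / (1 + μs)) 1 from Ioo_mem_nhdsLT hlt)).exists
  have hβ := betaOf_pos hμ0 hγ hγ1
  set β := betaOf μs γ
  have hμ' : 0 < muOf μs γ := div_pos hμ0 (by linarith)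
  obtain ⟨C, hC⟩ := H.capacity_sub_rate_le hγ hγ1
  set T : (n : ℕ) → Code n := fun n => thresholdCode z n ((2 : ℝ) ^ (-((2 : ℝ) ^ (β * n))))
  have hT : ∀ᶠ n in atTop, R ≤ rate (T n) := by
    have h0 : Tendsto (fun n : ℕ => C * (2 : ℝ) ^ (-(n : ℝ) / muOf μs γ)) atTop (𝓝 0) := by
      have h1 : Tendsto (fun n : ℕ => ((2 : ℝ) ^ (-1 / muOf μs γ)) ^ n) atTop (𝓝 0) := by
        refine tendsto_pow_atTop_nhds_zero_of_lt_one (by positivity) ?_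
        exact Real.rpow_lt_one_of_one_lt_of_neg one_lt_two (div_neg_of_neg_of_pos (by norm_num) hμ')
      have h2 := h1.const_mul C
      rw [mul_zero] at h2
      refine h2.congr fun n => ?_
      rw [← Real.rpow_natCast, ← Real.rpow_mul two_pos.le]
      congr 2; ring
    filter_upwards [h0.eventually_lt_const (sub_pos.2 hR)] with n hn
    linarith [hC z hzI n]
  classical
  -- The rate bound must hold at every `n`; the finitely many exceptions use all channels and do not
  -- affect the `liminf`.
  refine ⟨fun n => if R ≤ rate (T n) then T n else Finset.univ, fun n => ?_, ?_⟩
  · dsimp only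
    split_ifs with hn
    · exact hn
    · rw [rate_univ]
      rw [capacity] at hR
      linarith [hz.1]
  · refine le_liminf_of_le (by isBoundedDefault) ?_
    filter_upwards [hT, eventually_gt_atTop 0, eventually_mul_le_two_rpow hβ 2,
      tendsto_natCast_atTop_atTop.eventually_ge_atTop (2 / (β - b))] with n hn hn0 h1 h2
    have hn' : (0 : ℝ) < n := Nat.cast_pos.2 hn0
    rw [div_le_iff₀' (sub_pos.2 hbγ)] at h2
    rw [if_pos hn, EReal.coe_le_coe_iff, Real.log_pow, le_div_iff₀ (by positivity), ← mul_assoc]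
    exact mul_log_two_le_log_neg_log (blockError_pos hz (hR0.trans_le hn))
      (blockError_thresholdCode_le hzI n (by positivity)) h1 h2

theorem errorExponent_eq_half {z R : ℝ} (hz : z ∈ Set.Ioo (0 : ℝ) 1) (hR0 : 0 < R)
    (hR : R < capacity z) : errorExponent z R = ((1 / 2 : ℝ) : EReal) := by
  refine le_antisymm (sSup_le ?_) (le_of_forall_lt fun a ha => ?_)
  · rintro b ⟨A, hA, rfl⟩
    exact seqErrorExponent_le hz hR0 hA
  · obtain ⟨b, hab, hb⟩ := EReal.lt_iff_exists_real_btwn.1 ha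
    obtain ⟨A, hA, hbA⟩ :=
      eigenCondition_sqrt.exists_le_seqErrorExponent hz hR0 hR (EReal.coe_lt_coe_iff.1 hb)
    exact hab.trans_le (hbA.trans (le_sSup ⟨A, hA, rfl⟩))

end PolarCode

theorem mainTheorem3 :
    (∀ (h : ℝ → ℝ) (μs : ℝ), PolarCode.EigenCondition h μs →
      (∀ γ : ℝ, 1 / (1 + μs) < γ → γ < 1 →
        PolarCode.MainCondition μs (PolarCode.betaOf μs γ) (PolarCode.muOf μs γ) ∧
        ∀ z ∈ Set.Icc (0 : ℝ) 1,
          PolarCode.Achievable z (PolarCode.betaOf μs γ) (PolarCode.muOf μs γ)) ∧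
      Tendsto (fun γ : ℝ => PolarCode.betaOf μs γ) (𝓝[<] 1) (𝓝 (1 / 2))) ∧
    (∀ z ∈ Set.Ioo (0 : ℝ) 1, ∀ R : ℝ, 0 < R → R < PolarCode.capacity z →
      PolarCode.errorExponent z R = ((1 / 2 : ℝ) : EReal)) := by
  refine ⟨fun h μs H => ⟨fun γ hγ hγ1 => ⟨PolarCode.mainCondition H.two_lt hγ hγ1,
    fun z hz => H.achievable hγ hγ1 hz⟩, PolarCode.tendsto_betaOf (by linarith [H.two_lt])⟩,
    fun z hz R hR0 hR => PolarCode.errorExponent_eq_half hz hR0 hR⟩
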